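/- Let $k$ be a field and let $m\ge 1$ be an integer. An $m$-bonsai is a finite rooted tree in which the edges going down from any given vertex carry pairwise distinct labels from $\{1,\dots,m\}$ (so every vertex has at most $m$ children); label-preserving isomorphic trees are identified. Order the edges of an $m$-bonsai $T$ by the traversing order: start at the root and sweep around the tree depth first, taking the edges below each vertex by increasing label. If $e_1,\dots,e_n$ are the edges of $T$ in this order, put $\det(T)=e_1\wedge\dots\wedge e_n$ (with $\det(T)=1$ if $T$ has one vertex). Let $\mathbf C^n$ be the $k$-vector space with basis the elements $T\otimes\det(T)$, where $T$ runs over the $m$-bonsais (trees, not forests) with exactly $n$ edges. A tip is a vertex without children; in particular the root of the one-vertex bonsai is a tip. The vertex-appending differential $\partial:\mathbf C^n\to\mathbf C^{n+1}$ is $$\partial\bigl(T\otimes\det(T)\bigr)=\sum_{(T',e)} T'\otimes e\wedge\det(T),$$ where $(T',e)$ runs over all ways of obtaining an $m$-bonsai $T'$ from $T$ by appending one new vertex, by a new labelled edge $e$, to a vertex of $T$ that is not a tip (the sum is $0$ if there is none), and $e\wedge\det(T)=\pm\det(T')$ is computed in the exterior algebra on the edges of $T'$. Then $(\mathbf C^*,\partial)$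 is a cochain complex. Its cohomology groups $H^i$ are as follows. For every $i\ge 1$, $$H^i\cong\begin{cases} k^{\frac{(mn)!}{((m-1)n+1)!\,n!}} & \text{if } i=(2m-1)n+1 \text{ for some integer } n\ge 0,\\[2pt] 0 & \text{otherwise,}\end{cases}$$ where $\frac{(mn)!}{((m-1)n+1)!\,n!}$ is an integer (an $m$-Catalan number). Moreover $H^0\cong k$, given by the one-vertex bonsai. -/

import Mathlib

open CategoryTheory
open scoped Nat

universe u

/-- An `m`-bonsai: a finite rooted tree in which the edges going down from any given vertex carry
pairwise distinct labels from an `m`-element set (so that every vertex has at most `m` children).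
A vertex is recorded by the word of the edge labels on the path from the root to that vertex: the
root is the empty word, and the lower end of the edge with label `a` below `v` is `v ++ [a]`.
Up to isomorphism, such trees are exactly the finite prefix-closed sets of words that contain the
empty word. -/
@[ext]
structure Bonsai (m : ℕ) where
  verts : Finset (List (Fin m))
  root_mem : [] ∈ verts
  parent_mem : ∀ (v : List (Fin m)) (a : Fin m), v ++ [a] ∈ verts → v ∈ verts

namespace Bonsai

variable {m : ℕ}

/-- The edges of a bonsai; an edge is named after its lower end, so that the edges are the vertices
other than the root. The traversing order of the edges (start at the root and sweep around the
tree, the labels below each vertex increasing) is the lexicographic order `<` of words. -/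
def edges (T : Bonsai m) : Finset (List (Fin m)) := T.verts.erase []

/-- A tip is a vertex without children. In particular the root of the one-vertex bonsai is a tip,
and the root of any other bonsai is not. -/
def IsTip (T : Bonsai m) (v : List (Fin m)) : Prop :=
  v ∈ T.verts ∧ ∀ a : Fin m, v ++ [a] ∉ T.verts

instance (T : Bonsai m) (v : List (Fin m)) : Decidable (T.IsTip v) :=
  inferInstanceAs (Decidable (_ ∧ _))

/-- The edges that can be appended to `T`, each going down to a new vertex, from a vertex `v` of `T`
that is not a tip, with a label `a` that is still free below `v`. -/
def positions (T : Bonsai m) : Finset (List (Fin m)) :=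
  ((T.verts ×ˢ Finset.univ).filter
    (fun p : List (Fin m) × Fin m => ¬ T.IsTip p.1 ∧ p.1 ++ [p.2] ∉ T.verts)).image
      (fun p => p.1 ++ [p.2])

theorem mem_positions {T : Bonsai m} {e : List (Fin m)} :
    e ∈ T.positions ↔ ∃ (v : List (Fin m)) (a : Fin m), e = v ++ [a] ∧ v ∈ T.verts ∧
      ¬ T.IsTip v ∧ v ++ [a] ∉ T.verts := by
  simp only [positions, Finset.mem_image, Finset.mem_filter, Finset.mem_product, Finset.mem_univ,
    and_true, Prod.exists]
  constructor
  · rintro ⟨v, a, ⟨h1, h2, h3⟩, rfl⟩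
    exact ⟨v, a, rfl, h1, h2, h3⟩
  · rintro ⟨v, a, rfl, h1, h2, h3⟩
    exact ⟨v, a, ⟨h1, h2, h3⟩, rfl⟩

theorem ne_nil_of_mem_positions {T : Bonsai m} {e : List (Fin m)} (he : e ∈ T.positions) :
    e ≠ [] := by
  obtain ⟨v, a, rfl, -⟩ := mem_positions.1 he
  simp

theorem notMem_of_mem_positions {T : Bonsai m} {e : List (Fin m)} (he : e ∈ T.positions) :
    e ∉ T.verts := by
  obtain ⟨v, a, rfl, -, -, h⟩ := mem_positions.1 he
  exact h

theorem notMem_edges_of_mem_positions {T : Bonsai m} {e : List (Fin m)} (he : e ∈ T.positions) :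
    e ∉ T.edges :=
  fun h => notMem_of_mem_positions he (Finset.mem_of_mem_erase h)

/-- The bonsai obtained from `T` by appending the new edge `e`, together with its lower end. -/
def append (T : Bonsai m) (e : List (Fin m)) (he : e ∈ T.positions) : Bonsai m where
  verts := insert e T.verts
  root_mem := Finset.mem_insert_of_mem T.root_mem
  parent_mem := by
    intro v a h
    rcases Finset.mem_insert.1 h with h | h
    · obtain ⟨w, b, rfl, hw, -⟩ := mem_positions.1 he
      obtain ⟨rfl, -⟩ := List.append_inj' h rfl
      exact Finset.mem_insert_of_mem hw
    · exact Finset.mem_insert_of_mem (T.parent_mem v a h)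

theorem edges_append (T : Bonsai m) (e : List (Fin m)) (he : e ∈ T.positions) :
    (T.append e he).edges = insert e T.edges := by
  have := ne_nil_of_mem_positions he
  simp only [edges, append]
  rw [Finset.erase_insert_of_ne this]

theorem card_edges_append (T : Bonsai m) (e : List (Fin m)) (he : e ∈ T.positions) :
    (T.append e he).edges.card = T.edges.card + 1 := by
  rw [edges_append, Finset.card_insert_of_notMem (notMem_edges_of_mem_positions he)]

theorem positions_append (T : Bonsai m) (e : List (Fin m)) (he : e ∈ T.positions) :
    (T.append e he).positions = T.positions.erase e := by
  ext f
  obtain ⟨w, b, rfl, hw, hwt, hb⟩ := mem_positions.1 he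
  have key : ∀ v ∈ T.verts, ((T.append _ he).IsTip v ↔ T.IsTip v) := by
    intro v hv
    have hv' : v ∈ (T.append _ he).verts := Finset.mem_insert_of_mem hv
    simp only [IsTip, hv, hv', true_and]
    constructor
    · intro h a ha
      exact h a (Finset.mem_insert_of_mem ha)
    · intro h a ha
      rcases Finset.mem_insert.1 ha with ha | ha
      · obtain ⟨rfl, -⟩ := List.append_inj' ha rfl
        exact hwt ⟨hv, h⟩
      · exact h a ha
  rw [Finset.mem_erase, mem_positions, mem_positions]
  constructor
  · rintro ⟨v, a, rfl, hv, ht, ha⟩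
    have ha' : v ++ [a] ≠ w ++ [b] ∧ v ++ [a] ∉ T.verts := by
      simpa only [append, Finset.mem_insert, not_or] using ha
    refine ⟨ha'.1, v, a, rfl, ?_⟩
    rcases Finset.mem_insert.1 hv with rfl | hv2
    · refine absurd ⟨hv, fun c hc => ?_⟩ ht
      rcases Finset.mem_insert.1 hc with h | h
      · simp at h
      · exact hb (T.parent_mem _ _ h)
    · exact ⟨hv2, fun h => ht ((key v hv2).2 h), ha'.2⟩
  · rintro ⟨hne, v, a, rfl, hv, ht, ha⟩
    refine ⟨v, a, rfl, Finset.mem_insert_of_mem hv, fun h => ht ((key v hv).1 h), ?_⟩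
    simp only [append, Finset.mem_insert, not_or]
    exact ⟨hne, ha⟩

/-- The determinant term of a bonsai: the exterior product of its edges in the traversing order,
taken in the exterior algebra of the free module with one generator for each edge name. -/
noncomputable def det (k : Type u) [Field k] (T : Bonsai m) :
    ExteriorAlgebra k (List (Fin m) →₀ k) :=
  ((T.edges.sort (· ≤ ·)).map (fun e => ExteriorAlgebra.ι k (Finsupp.single e (1 : k)))).prod

/-- The sign that relates `e ∧ det T` to the determinant term of the bonsai obtained from `T` by
appending the edge `e`: see `wedge_det`. -/
def sign (k : Type u) [Field k] (T : Bonsai m) (e : List (Fin m)) : k :=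
  (-1) ^ (T.edges.filter (fun f => f < e)).card

theorem wedge_prod_map (k : Type u) [Field k] (e : List (Fin m)) (l : List (List (Fin m)))
    (hl : l.Pairwise (· ≤ ·)) :
    ExteriorAlgebra.ι k (Finsupp.single e (1 : k)) *
        (l.map (fun e => ExteriorAlgebra.ι k (Finsupp.single e (1 : k)))).prod =
      ((-1 : k) ^ (l.filter (fun f => f < e)).length) •
        ((l.orderedInsert (· ≤ ·) e).map
          (fun e => ExteriorAlgebra.ι k (Finsupp.single e (1 : k)))).prod := by
  induction l with
  | nil => simp
  | cons x l ih =>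
    rw [List.pairwise_cons] at hl
    by_cases h : e ≤ x
    · have h0 : (x :: l).filter (fun f => f < e) = [] := by
        rw [List.filter_eq_nil_iff]
        intro f hf
        have : e ≤ f := by
          rcases List.mem_cons.1 hf with rfl | hf
          · exact h
          · exact h.trans (hl.1 f hf)
        simpa using this
      rw [h0, List.orderedInsert_cons_of_le _ _ h]
      simp
    · have hx : x < e := not_le.1 h
      rw [List.orderedInsert_cons, if_neg h, List.filter_cons_of_pos (by simpa using hx)]
      simp only [List.map_cons, List.prod_cons, List.length_cons]
      have hanti := ExteriorAlgebra.ι_add_mul_swap (R := k) (Finsupp.single e (1 : k))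
        (Finsupp.single x (1 : k))
      rw [← mul_assoc, eq_neg_of_add_eq_zero_left hanti, neg_mul, mul_assoc, ih hl.2,
        mul_smul_comm, pow_succ]
      simp

/-- `e ∧ det T = ± det T'`, where `T'` is `T` with the edge `e` appended. -/
theorem wedge_det (k : Type u) [Field k] (T : Bonsai m) (e : List (Fin m))
    (he : e ∈ T.positions) :
    ExteriorAlgebra.ι k (Finsupp.single e (1 : k)) * T.det k =
      T.sign k e • (T.append e he).det k := by
  have hs : (T.append e he).edges.sort (· ≤ ·) =
      (T.edges.sort (· ≤ ·)).orderedInsert (· ≤ ·) e := by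
    rw [edges_append]
    refine List.Perm.eq_of_pairwise' (r := (· ≤ ·)) (Finset.pairwise_sort _ _)
      ((Finset.pairwise_sort T.edges (· ≤ ·)).orderedInsert e _) ?_
    refine List.Perm.trans ?_ (List.perm_orderedInsert _ e _).symm
    rw [← Multiset.coe_eq_coe, ← Multiset.cons_coe, Finset.sort_eq, Finset.sort_eq,
      Finset.insert_val_of_notMem (notMem_edges_of_mem_positions he)]
  have hc : (T.edges.filter (fun f => f < e)).card =
      ((T.edges.sort (· ≤ ·)).filter (fun f => f < e)).length := by
    rw [Finset.card_def, Finset.filter_val, ← Finset.sort_eq T.edges (· ≤ ·), Multiset.filter_coe,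
      Multiset.coe_card]
  rw [det, det, sign, hs, hc]
  exact wedge_prod_map k e _ (Finset.pairwise_sort _ _)

theorem sign_append_add (k : Type u) [Field k] (T : Bonsai m) {e f : List (Fin m)}
    (he : e ∈ T.positions) (hf : f ∈ T.positions) (hne : e ≠ f) :
    T.sign k e * (T.append e he).sign k f + T.sign k f * (T.append f hf).sign k e = 0 := by
  have h1 := notMem_edges_of_mem_positions he
  have h2 := notMem_edges_of_mem_positions hf
  simp only [sign, edges_append, Finset.filter_insert]
  rcases lt_or_gt_of_ne hne with h | h
  · rw [if_pos h, if_neg h.not_gt, Finset.card_insert_of_notMem (by simp [h1])]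
    ring
  · rw [if_neg h.not_gt, if_pos h, Finset.card_insert_of_notMem (by simp [h2])]
    ring

/-- The space of determinanted bonsais of degree `n`. Its basis is indexed by the `m`-bonsais
(trees, not forests) with `n` edges; the basis vector of `T` stands for `T ⊗ det T`. -/
abbrev Cochain (k : Type u) [Field k] (m n : ℕ) : Type u :=
  {T : Bonsai m // T.edges.card = n} →₀ k

/-- The vertex-appending differential: it sends `T ⊗ det T` to the sum of the `T' ⊗ (e ∧ det T)`,
where `T'` runs over the bonsais obtained from `T` by appending a new edge `e` to a vertex that is
not a tip. In terms of the basis, `T' ⊗ (e ∧ det T) = ± T' ⊗ det T'` with the sign `T.sign k e`. -/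
noncomputable def vertexAppend (k : Type u) [Field k] (m n : ℕ) :
    Cochain k m n →ₗ[k] Cochain k m (n + 1) :=
  Finsupp.linearCombination k fun T : {T : Bonsai m // T.edges.card = n} =>
    ∑ e ∈ T.1.positions.attach,
      Finsupp.single
        (⟨T.1.append e.1 e.2, by rw [card_edges_append, T.2]⟩ :
          {T : Bonsai m // T.edges.card = n + 1})
        (T.1.sign k e.1)

theorem vertexAppend_single (k : Type u) [Field k] (m n : ℕ)
    (T : {T : Bonsai m // T.edges.card = n}) (c : k) :
    vertexAppend k m n (Finsupp.single T c) = ∑ e ∈ T.1.positions.attach,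
      Finsupp.single (⟨T.1.append e.1 e.2, by rw [card_edges_append, T.2]⟩ :
        {T : Bonsai m // T.edges.card = n + 1}) (c * T.1.sign k e.1) := by
  rw [vertexAppend, Finsupp.linearCombination_single, Finset.smul_sum]
  simp

theorem vertexAppend_comp (k : Type u) [Field k] (m n : ℕ) :
    vertexAppend k m (n + 1) ∘ₗ vertexAppend k m n = 0 := by
  refine Finsupp.lhom_ext fun T c => ?_
  rw [LinearMap.comp_apply, vertexAppend_single, map_sum, LinearMap.zero_apply]
  simp only [vertexAppend_single]
  rw [Finset.sum_sigma']
  have hpos : ∀ (e : {e // e ∈ T.1.positions}) (f : {f // f ∈ (T.1.append e.1 e.2).positions}),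
      f.1 ≠ e.1 ∧ f.1 ∈ T.1.positions := by
    intro e f
    exact Finset.mem_erase.1 (positions_append T.1 e.1 e.2 ▸ f.2)
  have hpos' : ∀ (e : {e // e ∈ T.1.positions})
      (f : {f // f ∈ (T.1.append e.1 e.2).positions}),
      e.1 ∈ (T.1.append f.1 (hpos e f).2).positions := by
    intro e f
    rw [positions_append, Finset.mem_erase]
    exact ⟨(hpos e f).1.symm, e.2⟩
  refine Finset.sum_involution
    (fun x _ => ⟨⟨x.2.1, (hpos x.1 x.2).2⟩, ⟨x.1.1, hpos' x.1 x.2⟩⟩) ?_ ?_ ?_ ?_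
  · rintro ⟨e, f⟩ -
    have hT : (T.1.append e.1 e.2).append f.1 f.2 =
        (T.1.append f.1 (hpos e f).2).append e.1 (hpos' e f) := by
      ext1
      exact Finset.insert_comm _ _ _
    simp only [hT]
    rw [← Finsupp.single_add, mul_assoc, mul_assoc, ← mul_add,
      sign_append_add k T.1 e.2 (hpos e f).2 (hpos e f).1.symm]
    simp
  · rintro ⟨e, f⟩ - - h
    exact (hpos e f).1 (congrArg (fun x => x.1.1) h)
  · intro x _
    simp
  · rintro ⟨e, f⟩ -
    rfl

/-- The cochain complex of determinanted `m`-bonsais, graded by the number of edges, with the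
vertex-appending differential. -/
noncomputable def complex (k : Type u) [Field k] (m : ℕ) : CochainComplex (ModuleCat.{u} k) ℕ :=
  CochainComplex.of (fun n => ModuleCat.of k (Cochain k m n))
    (fun n => ModuleCat.ofHom (vertexAppend k m n))
    (fun n => by
      rw [← ModuleCat.ofHom_comp, vertexAppend_comp]
      rfl)

end Bonsai

/-!
Appending a vertex below a vertex that is not a tip creates a tip and does not change the set `I`
of non-tip vertices. Hence the complex splits into one summand for each `I`. In the summand of `I`
a bonsai is given by its edge set `F`, which is a set of children of elements of `I` that contains
`I` except for the root and contains at least one child of each element of `I`. Both conditions say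
that `F` meets certain blocks, and the differential is the exterior multiplication by the sum of
all edges, restricted to such transversals.

For an edge `p`, removing `p` wherever possible gives a homotopy from the identity to a map
(`reduce`) that vanishes except at the sets in which `p` is indispensable for some block and at the
sets that are turned into such a set by exchanging one element with `p`
(`reduce_eq_zero_of_essential`). Composing these maps for a set `L` of edges with at most one
element in each block shows that cocycles vanishing at the sets in which all of `L` is
indispensable are coboundaries (`exists_eq_diff`), and that, if cochains have vanishing coboundary
at these sets, their values there are values of cocycles (`exists_cocycle`).

If some vertex of `I` has a child in `I` and a child `p` outside `I`, then `p` is never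
indispensable and the summand is acyclic. Otherwise `I` is a full `m`-ary tree (or empty); with `L`
consisting of the child with label `0` of each leaf of `I`, there is exactly one bonsai in which
all of `L` is indispensable, and removing an edge from it never leaves a bonsai of the summand. So the cohomology has a basis indexed by these critical bonsais
(`nonempty_homology_equiv_critical`).

A full `m`-ary tree with `n` non-leaf nodes has `m * n` edges and `(m - 1) * n + 1` leaves, so that
its critical bonsai has `(2 * m - 1) * n + 1` edges. The number of these trees is computed by
counting ordered forests: taking off the first tree if it is a leaf, and its root otherwise, gives
a recursion that is also satisfied by the closed formula (`card_forest`).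
-/

/-! ### Transversals of a family of blocks and their cochain complex -/

namespace BlockComplex

/-- The sign `(-1) ^ #{f ∈ F | f < e}` of moving `e` to the front of the increasing word on `F`. -/
noncomputable def sgn (k : Type*) [Field k] {α : Type*} [LinearOrder α] (F : Finset α) (e : α) : k :=
  (-1) ^ (F.filter (fun f => f < e)).card

/-- The subsets of `B` that meet every block of the family `𝓑`. -/
def Admissible {α : Type*} (B : Finset α) (𝓑 : Set (Set α)) (F : Finset α) : Prop :=
  F ⊆ B ∧ ∀ b ∈ 𝓑, ∃ a ∈ b, a ∈ F

theorem Admissible.mono {α : Type*} {B : Finset α} {𝓑 : Set (Set α)} {F G : Finset α}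
    (h : Admissible B 𝓑 F) (hFG : F ⊆ G) (hG : G ⊆ B) : Admissible B 𝓑 G :=
  ⟨hG, fun b hb => by
    obtain ⟨a, ha, haF⟩ := h.2 b hb
    exact ⟨a, ha, hFG haF⟩⟩

variable {k : Type*} [Field k] {α : Type*} [LinearOrder α] [DecidableEq α]

theorem sgn_insert {F : Finset α} {p : α} (hp : p ∉ F) (e : α) :
    sgn k (insert p F) e = (if p < e then -1 else 1) * sgn k F e := by
  unfold sgn
  rw [Finset.filter_insert]
  split_ifs with h
  · rw [Finset.card_insert_of_notMem (by simp [hp]), pow_succ]; ring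
  · simp

theorem sgn_insert_self (F : Finset α) (p : α) : sgn k (insert p F) p = sgn k F p := by
  unfold sgn
  rw [Finset.filter_insert, if_neg (lt_irrefl p)]

theorem sgn_erase_self (F : Finset α) (p : α) : sgn k (F.erase p) p = sgn k F p := by
  by_cases h : p ∈ F
  · conv_rhs => rw [← Finset.insert_erase h, sgn_insert_self]
  · rw [Finset.erase_eq_of_notMem h]

omit [DecidableEq α] in
theorem sgn_mul_self (F : Finset α) (p : α) : sgn k F p * sgn k F p = 1 := by
  unfold sgn
  rw [← mul_pow]; simp

omit [DecidableEq α] in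
theorem ite_lt_add {e f : α} (h : e ≠ f) :
    (if e < f then (-1 : k) else 1) + (if f < e then -1 else 1) = 0 := by
  rcases lt_or_gt_of_ne h with h | h
  · simp [h, h.not_gt]
  · simp [h, h.not_gt]

theorem sgn_erase_anticomm {F : Finset α} {e f : α} (he : e ∈ F) (hf : f ∈ F) (h : e ≠ f) :
    sgn k F e * sgn k (F.erase e) f + sgn k F f * sgn k (F.erase f) e = 0 := by
  have h1 : sgn k F e = (if f < e then -1 else 1) * sgn k (F.erase f) e := by
    conv_lhs => rw [← Finset.insert_erase hf, sgn_insert (Finset.notMem_erase f F)]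
  have h2 : sgn k F f = (if e < f then -1 else 1) * sgn k (F.erase e) f := by
    conv_lhs => rw [← Finset.insert_erase he, sgn_insert (Finset.notMem_erase e F)]
  rw [h1, h2]
  linear_combination (sgn k (F.erase f) e * sgn k (F.erase e) f) * ite_lt_add (k := k) h

theorem sgn_insert_anticomm {F : Finset α} {e p : α} (he : e ∈ F) (hp : p ∉ F) :
    sgn k F e * sgn k (F.erase e) p + sgn k F p * sgn k (insert p F) e = 0 := by
  have h : e ≠ p := fun h => hp (h ▸ he)
  have h2 : sgn k F p = (if e < p then -1 else 1) * sgn k (F.erase e) p := by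
    conv_lhs => rw [← Finset.insert_erase he, sgn_insert (Finset.notMem_erase e F)]
  rw [sgn_insert hp, h2]
  have h3 : (if e < p then (-1 : k) else 1) * (if p < e then -1 else 1) = -1 := by
    rcases lt_or_gt_of_ne h with h | h
    · simp [h, h.not_gt]
    · simp [h, h.not_gt]
  linear_combination (sgn k (F.erase e) p * sgn k F e) * h3

omit [LinearOrder α] in
theorem Admissible.insert {B : Finset α} {𝓑 : Set (Set α)} {F : Finset α}
    (h : Admissible B 𝓑 F) {p : α} (hp : p ∈ B) : Admissible B 𝓑 (insert p F) :=
  ⟨Finset.insert_subset hp h.1, fun b hb => by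
    obtain ⟨a, ha, haF⟩ := h.2 b hb
    exact ⟨a, ha, Finset.mem_insert_of_mem haF⟩⟩

open Classical in
/-- The differential on functions on admissible sets: the value at `F` is the signed sum of the
values at the admissible sets obtained by removing one element of `F`. Functions are defined on
all finite sets; only their values at admissible sets matter. -/
noncomputable def diff (k : Type*) [Field k] (B : Finset α) (𝓑 : Set (Set α)) :
    (Finset α → k) →ₗ[k] (Finset α → k) where
  toFun x F := ∑ e ∈ F with Admissible B 𝓑 (F.erase e), sgn k F e * x (F.erase e)
  map_add' x y := by
    ext F
    simp [mul_add, Finset.sum_add_distrib]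
  map_smul' c x := by
    ext F
    simp only [Pi.smul_apply, smul_eq_mul, RingHom.id_apply, Finset.mul_sum]
    exact Finset.sum_congr rfl fun _ _ => by ring

open Classical in
theorem diff_apply (B : Finset α) (𝓑 : Set (Set α)) (x : Finset α → k) (F : Finset α) :
    diff k B 𝓑 x F = ∑ e ∈ F with Admissible B 𝓑 (F.erase e), sgn k F e * x (F.erase e) := by
  rfl

theorem diff_congr {B : Finset α} {𝓑 : Set (Set α)} {x y : Finset α → k}
    (h : ∀ F, Admissible B 𝓑 F → x F = y F) (F : Finset α) :
    diff k B 𝓑 x F = diff k B 𝓑 y F := by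
  classical
  rw [diff_apply, diff_apply]
  refine Finset.sum_congr rfl fun e he => ?_
  rw [h _ (Finset.mem_filter.1 he).2]

theorem diff_diff {B : Finset α} {𝓑 : Set (Set α)} (x : Finset α → k) {F : Finset α}
    (hF : Admissible B 𝓑 F) : diff k B 𝓑 (diff k B 𝓑 x) F = 0 := by
  classical
  simp only [diff_apply, Finset.mul_sum]
  rw [Finset.sum_sigma']
  have key : ∀ z ∈ (F.filter fun e => Admissible B 𝓑 (F.erase e)).sigma
      (fun e => (F.erase e).filter fun f => Admissible B 𝓑 ((F.erase e).erase f)),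
      z.1 ∈ F ∧ z.2 ∈ F ∧ z.2 ≠ z.1 ∧ Admissible B 𝓑 ((F.erase z.1).erase z.2) := by
    intro z hz
    simp only [Finset.mem_sigma, Finset.mem_filter, Finset.mem_erase] at hz
    tauto
  refine Finset.sum_involution (fun z _ => ⟨z.2, z.1⟩) ?_ ?_ ?_ ?_
  · intro z hz
    obtain ⟨h1, h2, h3, -⟩ := key z hz
    rw [Finset.erase_right_comm (a := z.2)]
    linear_combination x ((F.erase z.1).erase z.2) * sgn_erase_anticomm (k := k) h1 h2 h3.symm
  · intro z hz _ h
    exact (key z hz).2.2.1 (congrArg Sigma.fst h)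
  · intro z hz
    obtain ⟨h1, h2, h3, h4⟩ := key z hz
    simp only [Finset.mem_sigma, Finset.mem_filter, Finset.mem_erase]
    refine ⟨⟨h2, ?_⟩, ⟨h3.symm, h1⟩, ?_⟩
    · rw [Finset.erase_right_comm] at h4
      exact h4.mono (Finset.erase_subset _ _) ((Finset.erase_subset _ _).trans hF.1)
    · rwa [Finset.erase_right_comm]
  · intro z hz
    rfl

open Classical in
/-- The homotopy that contracts along the element `p`: in terms of basis elements it removes `p`. -/
noncomputable def contract (p : α) (x : Finset α → k) (F : Finset α) : k :=
  if p ∈ F then 0 else sgn k F p * x (insert p F)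

/-- The endomorphism `1 - (D h + h D)`, where `D` is the differential and `h` contracts along
`p`. -/
noncomputable def reduce (B : Finset α) (𝓑 : Set (Set α)) (p : α) (x : Finset α → k) :
    Finset α → k :=
  x - diff k B 𝓑 (contract p x) - contract p (diff k B 𝓑 x)

variable {B : Finset α} {𝓑 : Set (Set α)}

theorem reduce_eq_self {p : α} (x : Finset α → k) {F : Finset α} (hp : p ∈ F)
    (hpF : ¬ Admissible B 𝓑 (F.erase p)) : reduce B 𝓑 p x F = x F := by
  classical
  have h : diff k B 𝓑 (contract p x) F = 0 := by
    rw [diff_apply]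
    refine Finset.sum_eq_zero fun e he => ?_
    have hne : p ≠ e := by
      rintro rfl
      exact hpF (Finset.mem_filter.1 he).2
    simp [contract, hne, hp]
  simp [reduce, h, contract, hp]

theorem reduce_eq_zero_of_mem {p : α} (x : Finset α → k) {F : Finset α} (hp : p ∈ F)
    (hpF : Admissible B 𝓑 (F.erase p)) : reduce B 𝓑 p x F = 0 := by
  classical
  have h : diff k B 𝓑 (contract p x) F = x F := by
    rw [diff_apply, Finset.sum_eq_single_of_mem p (by simp [hp, hpF])]
    · simp only [contract, Finset.notMem_erase, if_false, Finset.insert_erase hp, sgn_erase_self]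
      rw [← mul_assoc, sgn_mul_self, one_mul]
    · intro e _ hne
      simp [contract, hne.symm, hp]
  simp [reduce, h, contract, hp]

theorem reduce_eq_zero_of_notMem {p : α} (hpB : p ∈ B) (x : Finset α → k) {F : Finset α}
    (hF : Admissible B 𝓑 F) (hp : p ∉ F)
    (hx : ∀ e ∈ F, ¬ Admissible B 𝓑 (F.erase e) → Admissible B 𝓑 ((insert p F).erase e) →
      x ((insert p F).erase e) = 0) : reduce B 𝓑 p x F = 0 := by
  classical
  have hne : ∀ e ∈ F, p ≠ e := fun e he h => hp (h ▸ he)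
  have h1 : contract p (diff k B 𝓑 x) F = x F + ∑ e ∈ F with Admissible B 𝓑 (F.erase e),
      sgn k F p * (sgn k (insert p F) e * x ((insert p F).erase e)) := by
    rw [contract, if_neg hp, diff_apply, Finset.filter_insert, Finset.erase_insert hp, if_pos hF,
      Finset.sum_insert (by simp [hp]), sgn_insert_self, Finset.erase_insert hp, mul_add,
      ← mul_assoc, sgn_mul_self, one_mul, Finset.mul_sum]
    congr 1
    symm
    refine Finset.sum_subset ?_ ?_
    · intro e he
      rw [Finset.mem_filter] at he ⊢
      refine ⟨he.1, ?_⟩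
      rw [Finset.erase_insert_of_ne (hne e he.1)]
      exact he.2.insert hpB
    · intro e he he'
      rw [Finset.mem_filter] at he he'
      rw [hx e he.1 (fun h => he' ⟨he.1, h⟩) he.2]
      simp
  have h2 : diff k B 𝓑 (contract p x) F = -∑ e ∈ F with Admissible B 𝓑 (F.erase e),
      sgn k F p * (sgn k (insert p F) e * x ((insert p F).erase e)) := by
    rw [diff_apply, ← Finset.sum_neg_distrib]
    refine Finset.sum_congr rfl fun e he => ?_
    have heF := (Finset.mem_filter.1 he).1
    have hpe : p ∉ F.erase e := fun h => hp (Finset.mem_of_mem_erase h)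
    rw [contract, if_neg hpe, Finset.erase_insert_of_ne (hne e heF)]
    linear_combination (x (insert p (F.erase e))) * sgn_insert_anticomm (k := k) heF hp
  simp [reduce, h1, h2]

/-- Every element of `L` lies in `F` and cannot be removed from it. -/
def Essential (B : Finset α) (𝓑 : Set (Set α)) (L F : Finset α) : Prop :=
  ∀ p ∈ L, p ∈ F ∧ ¬ Admissible B 𝓑 (F.erase p)

/-- One step of the reduction. The sets `F` at which `reduce B 𝓑 p x` may be nonzero are those in
which `p` is essential, and those from which such a set arises by exchanging an element `e` with
`p`. The exchange happens inside a block that contains `p`, hence it does not affect the elements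
of `L`. -/
theorem reduce_eq_zero_of_essential {p : α} {L : Finset α} (hpB : p ∈ B) (hpL : p ∉ L)
    (hL : ∀ b ∈ 𝓑, ∀ q ∈ L, p ∈ b → q ∉ b) {x : Finset α → k}
    (hx : ∀ F, Admissible B 𝓑 F → Essential B 𝓑 (insert p L) F → x F = 0) {F : Finset α}
    (hF : Admissible B 𝓑 F) (hFL : Essential B 𝓑 L F) : reduce B 𝓑 p x F = 0 := by
  classical
  by_cases hp : p ∈ F
  · by_cases hpF : Admissible B 𝓑 (F.erase p)
    · exact reduce_eq_zero_of_mem x hp hpF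
    · rw [reduce_eq_self x hp hpF]
      refine hx F hF fun q hq => ?_
      rcases Finset.mem_insert.1 hq with rfl | hq
      · exact ⟨hp, hpF⟩
      · exact hFL q hq
  · refine reduce_eq_zero_of_notMem hpB x hF hp fun e he hn ha => hx _ ha fun q hq => ?_
    have hpe : p ≠ e := fun h => hp (h ▸ he)
    rcases Finset.mem_insert.1 hq with rfl | hqL
    · refine ⟨by simp [hpe], ?_⟩
      rwa [Finset.erase_right_comm, Finset.erase_insert hp]
    · obtain ⟨hqF, hqn⟩ := hFL q hqL
      have hsub : ∀ e : α, F.erase e ⊆ B := fun e => (Finset.erase_subset _ _).trans hF.1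
      -- a block in which `e` is the only element of `F`
      have hb : ∃ b ∈ 𝓑, ∀ a ∈ b, a ∉ F.erase e := by
        by_contra! h
        exact hn ⟨hsub e, h⟩
      obtain ⟨b, hb𝓑, hb⟩ := hb
      have hpb : p ∈ b := by
        obtain ⟨a, hab, haF⟩ := ha.2 b hb𝓑
        rw [Finset.erase_insert_of_ne hpe, Finset.mem_insert] at haF
        rcases haF with rfl | haF
        · exact hab
        · exact absurd haF (hb a hab)
      have heb : e ∈ b := by
        obtain ⟨a, hab, haF⟩ := hF.2 b hb𝓑
        by_cases hae : a = e
        · exact hae ▸ hab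
        · exact absurd (Finset.mem_erase.2 ⟨hae, haF⟩) (hb a hab)
      have hqe : q ≠ e := by
        rintro rfl
        exact hL b hb𝓑 q hqL hpb heb
      refine ⟨by simp [hqe, hqF], fun hcon => hqn ⟨hsub q, fun b' hb' => ?_⟩⟩
      by_contra! h
      obtain ⟨a, hab, haF⟩ := hcon.2 b' hb'
      obtain ⟨a', hab', haF'⟩ := hF.2 b' hb'
      -- `q` is the only element of `F` in the block `b'`
      have hqb : q ∈ b' := by
        by_cases haq : a' = q
        · exact haq ▸ hab'
        · exact absurd (Finset.mem_erase.2 ⟨haq, haF'⟩) (h a' hab')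
      simp only [Finset.mem_erase, Finset.mem_insert] at haF
      rcases haF.2.2 with rfl | haF2
      · exact hL b' hb' q hqL hab hqb
      · exact h a hab (Finset.mem_erase.2 ⟨haF.1, haF2⟩)

theorem contract_eq_zero {p : α} (hpB : p ∈ B) {x : Finset α → k}
    (hx : ∀ F, Admissible B 𝓑 F → x F = 0) {F : Finset α} (hF : Admissible B 𝓑 F) :
    contract p x F = 0 := by
  classical
  rw [contract]
  split_ifs
  · rfl
  · rw [hx _ (hF.insert hpB), mul_zero]

/-- A cocycle that vanishes at all sets in which the elements of `L` are essential is a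
coboundary, provided that `L` has at most one element in each block. -/
theorem exists_eq_diff (L : Finset α) (hLB : L ⊆ B)
    (hL : ∀ b ∈ 𝓑, ∀ p ∈ L, ∀ q ∈ L, p ∈ b → q ∈ b → p = q) (x : Finset α → k)
    (hdx : ∀ F, Admissible B 𝓑 F → diff k B 𝓑 x F = 0)
    (hx : ∀ F, Admissible B 𝓑 F → Essential B 𝓑 L F → x F = 0) :
    ∃ y : Finset α → k, ∀ F, Admissible B 𝓑 F → x F = diff k B 𝓑 y F := by
  classical
  induction L using Finset.induction_on generalizing x with
  | empty =>
    refine ⟨0, fun F hF => ?_⟩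
    rw [hx F hF (by simp [Essential]), map_zero]
    rfl
  | insert p L hpL ih =>
    have hpB : p ∈ B := hLB (Finset.mem_insert_self _ _)
    have hred : ∀ F, Admissible B 𝓑 F → reduce B 𝓑 p x F = x F - diff k B 𝓑 (contract p x) F := by
      intro F hF
      simp [reduce, contract_eq_zero hpB hdx hF]
    obtain ⟨y, hy⟩ := ih ((Finset.subset_insert _ _).trans hLB)
      (fun b hb q hq r hr => hL b hb q (Finset.mem_insert_of_mem hq) r (Finset.mem_insert_of_mem hr))
      (reduce B 𝓑 p x)
      (fun F hF => by
        rw [diff_congr (y := x - diff k B 𝓑 (contract p x)) (by simpa using hred), map_sub,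
          Pi.sub_apply, hdx F hF, diff_diff _ hF, sub_zero])
      (fun F hF hFL => reduce_eq_zero_of_essential hpB hpL
        (fun b hb q hq hpb hqb => hpL (by
          rwa [hL b hb p (Finset.mem_insert_self _ _) q (Finset.mem_insert_of_mem hq) hpb hqb]))
        hx hF hFL)
    refine ⟨y + contract p x, fun F hF => ?_⟩
    have h := hred F hF
    rw [hy F hF] at h
    rw [map_add, Pi.add_apply, h]
    ring

/-- A cochain whose coboundary vanishes at all sets in which the elements of `L` are essential can
be changed, away from these sets, into a cocycle. -/
theorem exists_cocycle (L : Finset α) (hLB : L ⊆ B)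
    (hL : ∀ b ∈ 𝓑, ∀ p ∈ L, ∀ q ∈ L, p ∈ b → q ∈ b → p = q) (x : Finset α → k)
    (hx : ∀ F, Admissible B 𝓑 F → Essential B 𝓑 L F → diff k B 𝓑 x F = 0) :
    ∃ z : Finset α → k, (∀ F, Admissible B 𝓑 F → diff k B 𝓑 z F = 0) ∧
      ∀ F, Admissible B 𝓑 F → Essential B 𝓑 L F → z F = x F := by
  classical
  induction L using Finset.induction_on generalizing x with
  | empty => exact ⟨x, fun F hF => hx F hF (by simp [Essential]), fun _ _ _ => rfl⟩
  | insert p L hpL ih =>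
    have hpB : p ∈ B := hLB (Finset.mem_insert_self _ _)
    -- the reduction commutes with the differential
    have hcomm : ∀ F, Admissible B 𝓑 F →
        diff k B 𝓑 (reduce B 𝓑 p x) F = reduce B 𝓑 p (diff k B 𝓑 x) F := by
      intro F hF
      simp only [reduce, map_sub, Pi.sub_apply]
      rw [diff_diff _ hF, contract_eq_zero hpB (fun G hG => diff_diff x hG) hF]
      ring
    obtain ⟨z, hz, hzx⟩ := ih ((Finset.subset_insert _ _).trans hLB)
      (fun b hb q hq r hr => hL b hb q (Finset.mem_insert_of_mem hq) r (Finset.mem_insert_of_mem hr))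
      (reduce B 𝓑 p x)
      (fun F hF hFL => by
        rw [hcomm F hF]
        exact reduce_eq_zero_of_essential hpB hpL
          (fun b hb q hq hpb hqb => hpL (by
            rwa [hL b hb p (Finset.mem_insert_self _ _) q (Finset.mem_insert_of_mem hq) hpb hqb]))
          hx hF hFL)
    refine ⟨z, hz, fun F hF hFL => ?_⟩
    rw [hzx F hF fun q hq => hFL q (Finset.mem_insert_of_mem hq)]
    obtain ⟨h1, h2⟩ := hFL p (Finset.mem_insert_self _ _)
    exact reduce_eq_self x h1 h2

end BlockComplex

/-! ### Bonsais with given non-tip vertices -/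

namespace Bonsai

variable {m : ℕ}

open Classical in
/-- The vertices of a bonsai that are not tips. Appending an edge does not change them. -/
noncomputable def nonTips (T : Bonsai m) : Finset (List (Fin m)) :=
  T.verts.filter fun v => ∃ a, v ++ [a] ∈ T.verts

theorem mem_nonTips {T : Bonsai m} {v : List (Fin m)} :
    v ∈ T.nonTips ↔ ∃ a, v ++ [a] ∈ T.verts := by
  simp only [nonTips, Finset.mem_filter, and_iff_right_iff_imp]
  rintro ⟨a, ha⟩
  exact T.parent_mem v a ha

theorem mem_verts_of_mem_nonTips {T : Bonsai m} {v : List (Fin m)} (h : v ∈ T.nonTips) :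
    v ∈ T.verts := by
  obtain ⟨a, ha⟩ := mem_nonTips.1 h
  exact T.parent_mem v a ha

theorem append_singleton_mem_edges {T : Bonsai m} {v : List (Fin m)} {a : Fin m} :
    v ++ [a] ∈ T.edges ↔ v ++ [a] ∈ T.verts := by
  simp [edges]

theorem insert_nil_edges (T : Bonsai m) : insert [] T.edges = T.verts :=
  Finset.insert_erase T.root_mem

theorem edges_injective : Function.Injective (edges : Bonsai m → Finset (List (Fin m))) := by
  intro T T' h
  ext1
  rw [← insert_nil_edges, ← insert_nil_edges, h]

theorem append_singleton_inj {v w : List (Fin m)} {a b : Fin m} :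
    v ++ [a] = w ++ [b] ↔ v = w ∧ a = b := by
  simp

/-- The words that extend a word of `I` by one letter. -/
def slots (I : Finset (List (Fin m))) : Finset (List (Fin m)) :=
  (I ×ˢ Finset.univ).image fun p => p.1 ++ [p.2]

theorem mem_slots {I : Finset (List (Fin m))} {w : List (Fin m)} :
    w ∈ slots I ↔ ∃ v ∈ I, ∃ a, w = v ++ [a] := by
  simp only [slots, Finset.mem_image, Finset.mem_product, Finset.mem_univ, and_true, Prod.exists]
  constructor
  · rintro ⟨v, a, hv, rfl⟩
    exact ⟨v, hv, a, rfl⟩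
  · rintro ⟨v, hv, a, rfl⟩
    exact ⟨v, a, hv, rfl⟩

theorem append_singleton_mem_slots {I : Finset (List (Fin m))} {v : List (Fin m)} {a : Fin m} :
    v ++ [a] ∈ slots I ↔ v ∈ I := by
  simp [mem_slots]

/-- The blocks that the edge set of a bonsai with non-tip vertices `I` has to meet: each `v ∈ I`
other than the root has to be a vertex, and each `v ∈ I` has to have a child. -/
def blocks (I : Finset (List (Fin m))) : Set (Set (List (Fin m))) :=
  {b | (∃ v ∈ I, v ≠ [] ∧ b = {v}) ∨ ∃ v ∈ I, b = {w | ∃ a, w = v ++ [a]}}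

/-- By `edges_admissible` and `edges_ofAdmissible`, these are the edge sets of the bonsais whose
non-tip vertices form the set `I`. -/
abbrev EdgeSet (I F : Finset (List (Fin m))) : Prop :=
  BlockComplex.Admissible (slots I) (blocks I) F

theorem edgeSet_iff {I F : Finset (List (Fin m))} :
    EdgeSet I F ↔ F ⊆ slots I ∧ (∀ v ∈ I, v ≠ [] → v ∈ F) ∧ ∀ v ∈ I, ∃ a, v ++ [a] ∈ F := by
  refine and_congr_right fun _ => ⟨fun h => ⟨fun v hv hne => ?_, fun v hv => ?_⟩, ?_⟩
  · obtain ⟨a, rfl, ha⟩ := h {v} (Or.inl ⟨v, hv, hne, rfl⟩)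
    exact ha
  · obtain ⟨w, ⟨a, rfl⟩, ha⟩ := h _ (Or.inr ⟨v, hv, rfl⟩)
    exact ⟨a, ha⟩
  · rintro ⟨h1, h2⟩ b (⟨v, hv, hne, rfl⟩ | ⟨v, hv, rfl⟩)
    · exact ⟨v, rfl, h1 v hv hne⟩
    · obtain ⟨a, ha⟩ := h2 v hv
      exact ⟨v ++ [a], ⟨a, rfl⟩, ha⟩

theorem edges_admissible (T : Bonsai m) : EdgeSet T.nonTips T.edges := by
  rw [edgeSet_iff]
  refine ⟨fun w hw => ?_, fun v hv hne => ?_, fun v hv => ?_⟩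
  · rcases List.eq_nil_or_concat' w with rfl | ⟨v, a, rfl⟩
    · simp [edges] at hw
    · rw [append_singleton_mem_slots, mem_nonTips]
      exact ⟨a, append_singleton_mem_edges.1 hw⟩
  · exact Finset.mem_erase.2 ⟨hne, mem_verts_of_mem_nonTips hv⟩
  · obtain ⟨a, ha⟩ := mem_nonTips.1 hv
    exact ⟨a, append_singleton_mem_edges.2 ha⟩

/-- The bonsai with edge set `F` and non-tip vertices `I`. -/
def ofAdmissible {I F : Finset (List (Fin m))} (h : EdgeSet I F) : Bonsai m where
  verts := insert [] F
  root_mem := Finset.mem_insert_self _ _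
  parent_mem v a hv := by
    rw [edgeSet_iff] at h
    have hF : v ++ [a] ∈ F := by simpa using hv
    have hI := append_singleton_mem_slots.1 (h.1 hF)
    by_cases hne : v = []
    · simp [hne]
    · exact Finset.mem_insert_of_mem (h.2.1 v hI hne)

theorem edges_ofAdmissible {I F : Finset (List (Fin m))} (h : EdgeSet I F) :
    (ofAdmissible h).edges = F := by
  refine Finset.erase_insert fun hn => ?_
  obtain ⟨v, -, a, hva⟩ := mem_slots.1 (h.1 hn)
  simp at hva

theorem nonTips_ofAdmissible {I F : Finset (List (Fin m))} (h : EdgeSet I F) :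
    (ofAdmissible h).nonTips = I := by
  ext v
  simp only [mem_nonTips, ← append_singleton_mem_edges, edges_ofAdmissible]
  rw [edgeSet_iff] at h
  exact ⟨fun ⟨a, ha⟩ => append_singleton_mem_slots.1 (h.1 ha), h.2.2 v⟩

theorem nonTips_append (T : Bonsai m) (e : List (Fin m)) (he : e ∈ T.positions) :
    (T.append e he).nonTips = T.nonTips := by
  ext v
  obtain ⟨w, b, rfl, hw, hwt, hb⟩ := mem_positions.1 he
  simp only [mem_nonTips, append, Finset.mem_insert, append_singleton_inj]
  constructor
  · rintro ⟨a, ⟨rfl, rfl⟩ | h⟩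
    · by_contra! hcon
      exact hwt ⟨hw, hcon⟩
    · exact ⟨a, h⟩
  · rintro ⟨a, h⟩
    exact ⟨a, Or.inr h⟩

/-- Removing an edge while keeping the same non-tip vertices is inverse to appending an edge. -/
theorem exists_append_eq {T T' : Bonsai m} {e : List (Fin m)} (he : e ∈ T'.edges)
    (hT : T.edges = T'.edges.erase e) (hadm : EdgeSet T'.nonTips (T'.edges.erase e)) :
    ∃ hp : e ∈ T.positions, T.append e hp = T' := by
  have hedge : e ∈ slots T'.nonTips := T'.edges_admissible.1 he
  obtain ⟨v, hv, a, rfl⟩ := mem_slots.1 hedge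
  have hTe : T = ofAdmissible hadm := edges_injective (by rw [hT, edges_ofAdmissible])
  have hv' : v ∈ T.nonTips := by rwa [hTe, nonTips_ofAdmissible]
  have hp : v ++ [a] ∈ T.positions := by
    refine mem_positions.2 ⟨v, a, rfl, mem_verts_of_mem_nonTips hv', fun h => ?_, ?_⟩
    · obtain ⟨b, hb⟩ := mem_nonTips.1 hv'
      exact h.2 b hb
    · rw [← append_singleton_mem_edges, hT]
      exact Finset.notMem_erase _ _
  refine ⟨hp, edges_injective ?_⟩
  rw [edges_append, hT, Finset.insert_erase he]

theorem append_injective {T : Bonsai m} {e f : List (Fin m)} {he : e ∈ T.positions}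
    {hf : f ∈ T.positions} (h : T.append e he = T.append f hf) : e = f := by
  have h1 : e ∈ (T.append f hf).verts := h ▸ Finset.mem_insert_self _ _
  rcases Finset.mem_insert.1 h1 with h1 | h1
  · exact h1
  · exact absurd h1 (notMem_of_mem_positions he)

/-! ### The vertex-appending differential in coordinates -/

open BlockComplex

theorem sgn_edges {k : Type u} [Field k] (T : Bonsai m) (e : List (Fin m)) :
    sgn k T.edges e = T.sign k e := by
  unfold sgn sign
  congr!

theorem vertexAppend_single_apply {k : Type u} [Field k] {n : ℕ}
    (T : {T : Bonsai m // T.edges.card = n}) (c : k)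
    (T' : {T : Bonsai m // T.edges.card = n + 1}) :
    vertexAppend k m n (Finsupp.single T c) T' =
      diff k (slots T'.1.nonTips) (blocks T'.1.nonTips) (Finsupp.single T.1.edges c)
        T'.1.edges := by
  classical
  rw [vertexAppend_single, Finsupp.finsetSum_apply, diff_apply]
  by_cases h : ∃ (e : List (Fin m)) (he : e ∈ T.1.positions), T.1.append e he = T'.1
  · obtain ⟨e, he, hT'⟩ := h
    have hne := notMem_edges_of_mem_positions he
    rw [Finset.sum_eq_single_of_mem ⟨e, he⟩ (Finset.mem_attach _ _),
      Finset.sum_eq_single_of_mem e]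
    · simp only [← hT', edges_append, Finset.erase_insert hne, Finsupp.single_eq_same]
      rw [Finsupp.single_apply, if_pos (Subtype.ext hT'), sgn_insert_self, mul_comm,
        sgn_edges]
    · rw [Finset.mem_filter, ← hT', edges_append, Finset.erase_insert hne, nonTips_append]
      exact ⟨Finset.mem_insert_self _ _, T.1.edges_admissible⟩
    · intro f hf hfe
      rw [Finset.mem_filter] at hf
      rw [Finsupp.single_apply, if_neg, mul_zero]
      intro hc
      obtain ⟨hp, hp'⟩ := exists_append_eq hf.1 hc hf.2
      exact hfe (append_injective (hp'.trans hT'.symm))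
    · rintro f - hfe
      rw [Finsupp.single_apply, if_neg]
      intro hc
      exact hfe (Subtype.ext (append_injective (he := f.2) ((Subtype.ext_iff.1 hc).trans hT'.symm)))
  · rw [Finset.sum_eq_zero, Finset.sum_eq_zero]
    · intro e he
      rw [Finset.mem_filter] at he
      rw [Finsupp.single_apply, if_neg, mul_zero]
      intro hc
      obtain ⟨hp, hp'⟩ := exists_append_eq he.1 hc he.2
      exact h ⟨e, hp, hp'⟩
    · rintro e -
      rw [Finsupp.single_apply, if_neg]
      intro hc
      exact h ⟨e.1, e.2, Subtype.ext_iff.1 hc⟩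

theorem edges_val_injective {n : ℕ} :
    Function.Injective fun T : {T : Bonsai m // T.edges.card = n} => T.1.edges :=
  fun _ _ h => Subtype.ext (edges_injective h)

/-- A cochain, as a function on all finite sets of words that vanishes away from the edge sets of
bonsais of the given degree. -/
noncomputable def extend {k : Type u} [Field k] {n : ℕ} (x : Cochain k m n) :
    Finset (List (Fin m)) → k :=
  x.mapDomain fun T => T.1.edges

theorem extend_edges {k : Type u} [Field k] {n : ℕ} (x : Cochain k m n)
    (T : {T : Bonsai m // T.edges.card = n}) : extend x T.1.edges = x T :=
  Finsupp.mapDomain_apply edges_val_injective x T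

theorem extend_of_card_ne {k : Type u} [Field k] {n : ℕ} (x : Cochain k m n)
    {F : Finset (List (Fin m))} (hF : F.card ≠ n) : extend x F = 0 := by
  refine Finsupp.mapDomain_of_notMem_range x F ?_
  rintro ⟨T, rfl⟩
  exact hF T.2

theorem vertexAppend_apply_extend {k : Type u} [Field k] {n : ℕ} (x : Cochain k m n)
    (T' : {T : Bonsai m // T.edges.card = n + 1}) :
    vertexAppend k m n x T' =
      diff k (slots T'.1.nonTips) (blocks T'.1.nonTips) (extend x) T'.1.edges := by
  unfold extend
  induction x using Finsupp.induction_linear with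
  | zero => simp
  | add x y hx hy =>
    rw [map_add, Finsupp.add_apply, hx, hy, Finsupp.mapDomain_add, Finsupp.coe_add, map_add,
      Pi.add_apply]
  | single T c => rw [vertexAppend_single_apply, Finsupp.mapDomain_single]

theorem vertexAppend_apply {k : Type u} [Field k] {n : ℕ} (x : Cochain k m n)
    (T' : {T : Bonsai m // T.edges.card = n + 1}) (X : Finset (List (Fin m)) → k)
    (hX : ∀ T : {T : Bonsai m // T.edges.card = n}, T.1.nonTips = T'.1.nonTips →
      X T.1.edges = x T) :
    vertexAppend k m n x T' =
      diff k (slots T'.1.nonTips) (blocks T'.1.nonTips) X T'.1.edges := by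
  classical
  rw [vertexAppend_apply_extend, diff_apply, diff_apply]
  refine Finset.sum_congr rfl fun e he => ?_
  rw [Finset.mem_filter] at he
  have hcard : (ofAdmissible he.2).edges.card = n := by
    rw [edges_ofAdmissible, Finset.card_erase_of_mem he.1, T'.2, Nat.add_sub_cancel]
  have h1 := extend_edges x ⟨ofAdmissible he.2, hcard⟩
  have h2 := hX ⟨ofAdmissible he.2, hcard⟩ (nonTips_ofAdmissible he.2)
  simp only [edges_ofAdmissible] at h1 h2
  rw [h1, h2]

/-! ### Critical bonsais -/

/-- A bonsai is critical if each of its non-tip vertices either has all `m` children, none of them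
a tip, or has only one child, which is a tip and has label `0`. -/
def IsCritical [NeZero m] (T : Bonsai m) : Prop :=
  ∀ v ∈ T.nonTips, (∀ a, v ++ [a] ∈ T.nonTips) ∨
    ∀ a, v ++ [a] ∈ T.verts → a = 0 ∧ v ++ [a] ∉ T.nonTips

theorem edgeSet_erase {I F : Finset (List (Fin m))} (hF : EdgeSet I F) {v : List (Fin m)}
    {a b : Fin m} (ha : v ++ [a] ∉ I) (hb : v ++ [b] ∈ F) (hba : b ≠ a) :
    EdgeSet I (F.erase (v ++ [a])) := by
  rw [edgeSet_iff] at hF ⊢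
  refine ⟨(Finset.erase_subset _ _).trans hF.1, fun w hw hne => ?_, fun w hw => ?_⟩
  · refine Finset.mem_erase.2 ⟨?_, hF.2.1 w hw hne⟩
    rintro rfl
    exact ha hw
  · by_cases hwv : w = v
    · subst hwv
      exact ⟨b, Finset.mem_erase.2 ⟨by simpa using hba, hb⟩⟩
    · obtain ⟨c, hc⟩ := hF.2.2 w hw
      exact ⟨c, Finset.mem_erase.2 ⟨by simp [hwv], hc⟩⟩

theorem IsCritical.not_edgeSet_erase [NeZero m] {T : Bonsai m} (hT : T.IsCritical)
    {e : List (Fin m)} (he : e ∈ T.edges) : ¬ EdgeSet T.nonTips (T.edges.erase e) := by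
  intro h
  rw [edgeSet_iff] at h
  obtain ⟨v, hv, a, rfl⟩ := mem_slots.1 (T.edges_admissible.1 he)
  rcases hT v hv with hall | hone
  · exact Finset.notMem_erase _ _ (h.2.1 _ (hall a) (by simp))
  · obtain ⟨c, hc⟩ := h.2.2 v hv
    have hc' := append_singleton_mem_edges.1 (Finset.mem_of_mem_erase hc)
    rw [(hone c hc').1, ← (hone a (append_singleton_mem_edges.1 he)).1] at hc
    exact Finset.notMem_erase _ _ hc

/-- If some vertex of `I` has both a child in `I` and a child outside `I`, then the child outside
`I` can be added and removed freely and no bonsai is critical. Otherwise the critical bonsai is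
found by choosing the child with label `0` below each leaf of `I`. -/
theorem exists_essential_iff [NeZero m] (I : Finset (List (Fin m))) :
    ∃ L ⊆ slots I, (∀ b ∈ blocks I, ∀ p ∈ L, ∀ q ∈ L, p ∈ b → q ∈ b → p = q) ∧
      ∀ T : Bonsai m, T.nonTips = I →
        (Essential (slots I) (blocks I) L T.edges ↔ T.IsCritical) := by
  classical
  by_cases hI : ∃ v ∈ I, ∃ a b, v ++ [a] ∉ I ∧ v ++ [b] ∈ I
  · obtain ⟨v, hv, a, b, ha, hb⟩ := hI
    refine ⟨{v ++ [a]}, by simpa [append_singleton_mem_slots] using hv, ?_, ?_⟩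
    · intro c _ p hp q hq _ _
      rw [Finset.mem_singleton.1 hp, Finset.mem_singleton.1 hq]
    · rintro T rfl
      constructor
      · intro h
        have hbF : v ++ [b] ∈ T.edges :=
          append_singleton_mem_edges.2 (mem_verts_of_mem_nonTips hb)
        have hba : b ≠ a := by
          rintro rfl
          exact ha hb
        exact absurd (edgeSet_erase T.edges_admissible ha hbF hba)
          (h _ (Finset.mem_singleton_self _)).2
      · intro h
        rcases h v hv with h | h
        · exact absurd (h a) ha
        · exact absurd hb (h b (mem_verts_of_mem_nonTips hb)).2
  · push Not at hI
    refine ⟨(I.filter fun v => ∀ a, v ++ [a] ∉ I).image fun v => v ++ [0], ?_, ?_, ?_⟩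
    · intro w hw
      obtain ⟨v, hv, rfl⟩ := Finset.mem_image.1 hw
      exact append_singleton_mem_slots.2 (Finset.mem_filter.1 hv).1
    · intro b hb p hp q hq hpb hqb
      rcases hb with ⟨v, -, -, rfl⟩ | ⟨v, -, rfl⟩
      · exact hpb.trans hqb.symm
      · obtain ⟨v1, -, rfl⟩ := Finset.mem_image.1 hp
        obtain ⟨v2, -, rfl⟩ := Finset.mem_image.1 hq
        obtain ⟨a, h1⟩ := hpb
        obtain ⟨c, h2⟩ := hqb
        simp only [append_singleton_inj] at h1 h2 ⊢
        exact ⟨h1.1.trans h2.1.symm, trivial⟩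
    · rintro T rfl
      constructor
      · intro h v hv
        by_cases hc : ∃ b, v ++ [b] ∈ T.nonTips
        · obtain ⟨b, hb⟩ := hc
          left
          intro a
          by_contra ha
          exact hI v hv a b ha hb
        · push Not at hc
          obtain ⟨-, h2⟩ := h (v ++ [0]) (Finset.mem_image_of_mem _ (by simp [hv, hc]))
          refine Or.inr fun a ha => ⟨?_, hc a⟩
          by_contra hne
          exact h2 (edgeSet_erase T.edges_admissible (hc 0)
            (append_singleton_mem_edges.2 ha) hne)
      · intro h p hp
        obtain ⟨v, hv, rfl⟩ := Finset.mem_image.1 hp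
        rw [Finset.mem_filter] at hv
        have hone := (h v hv.1).resolve_left fun h => hv.2 0 (h 0)
        obtain ⟨a, ha⟩ := mem_nonTips.1 hv.1
        obtain rfl := (hone a ha).1
        exact ⟨append_singleton_mem_edges.2 ha,
          h.not_edgeSet_erase (append_singleton_mem_edges.2 ha)⟩

theorem mem_verts_of_append_mem {T : Bonsai m} {u v : List (Fin m)} (h : u ++ v ∈ T.verts) :
    u ∈ T.verts := by
  induction v using List.reverseRecOn with
  | nil => simpa using h
  | append_singleton v a ih =>
    rw [← List.append_assoc] at h
    exact ih (T.parent_mem _ _ h)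

theorem length_le_card_edges {T : Bonsai m} {v : List (Fin m)} (hv : v ∈ T.verts) :
    v.length ≤ T.edges.card := by
  have h : ((Finset.range (v.length + 1)).image v.take) ⊆ T.verts := by
    intro w hw
    obtain ⟨i, -, rfl⟩ := Finset.mem_image.1 hw
    exact mem_verts_of_append_mem (v := v.drop i) (by rwa [List.take_append_drop])
  have hcard := Finset.card_le_card h
  rw [Finset.card_image_of_injOn, Finset.card_range] at hcard
  · rw [edges, Finset.card_erase_of_mem T.root_mem]
    omega
  · intro i hi j hj hij
    have := congrArg List.length hij
    simp only [Finset.coe_range, Set.mem_Iio] at hi hj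
    simp only [List.length_take] at this
    omega

instance finite_degree (n : ℕ) : Finite {T : Bonsai m // T.edges.card = n} := by
  have hfin : {w : List (Fin m) | w.length ≤ n}.Finite := List.finite_length_le _ _
  refine Set.Finite.to_subtype (Set.Finite.of_injOn (f := Bonsai.verts)
    (t := hfin.toFinset.powerset) ?_ ?_ (Finset.finite_toSet _))
  · intro T hT
    simp only [Finset.mem_coe, Finset.mem_powerset]
    intro w hw
    have hT' : T.edges.card = n := hT
    rw [Set.Finite.mem_toFinset, Set.mem_ofPred_eq, ← hT']
    exact length_le_card_edges hw
  · intro T _ T' _ h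
    exact Bonsai.ext h

/-! ### The cohomology in terms of critical bonsais -/

section Cohomology

variable {k : Type u} [Field k] [NeZero m]

theorem vertexAppend_apply_of_isCritical {n : ℕ} (x : Cochain k m n)
    (T : {T : Bonsai m // T.edges.card = n + 1}) (hT : T.1.IsCritical) :
    vertexAppend k m n x T = 0 := by
  classical
  rw [vertexAppend_apply_extend, diff_apply, Finset.filter_false_of_mem, Finset.sum_empty]
  exact fun e he => hT.not_edgeSet_erase he

/-- The cochain whose value at `T` is the value at the edge set of `T` of the function attached to
the set of non-tip vertices of `T`. -/
noncomputable def glue (y : Finset (List (Fin m)) → Finset (List (Fin m)) → k) (n : ℕ) :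
    Cochain k m n :=
  Finsupp.equivFunOnFinite.symm fun T => y T.1.nonTips T.1.edges

omit [NeZero m] in
theorem vertexAppend_glue (y : Finset (List (Fin m)) → Finset (List (Fin m)) → k) (n : ℕ)
    (T : {T : Bonsai m // T.edges.card = n + 1}) :
    vertexAppend k m n (glue y n) T =
      diff k (slots T.1.nonTips) (blocks T.1.nonTips) (y T.1.nonTips) T.1.edges :=
  vertexAppend_apply _ _ _ fun S hS => by simp [glue, hS]

/-- A cocycle that vanishes at the critical bonsais is, on the bonsais with given non-tip vertices,
a coboundary. -/
theorem exists_primitive {n : ℕ} (x : Cochain k m n) (hdx : vertexAppend k m n x = 0)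
    (hx : ∀ T : {T : Bonsai m // T.edges.card = n}, T.1.IsCritical → x T = 0) :
    ∃ y : Finset (List (Fin m)) → Finset (List (Fin m)) → k,
      ∀ T : {T : Bonsai m // T.edges.card = n},
        x T = diff k (slots T.1.nonTips) (blocks T.1.nonTips) (y T.1.nonTips) T.1.edges := by
  classical
  have key : ∀ I : Finset (List (Fin m)), ∃ y : Finset (List (Fin m)) → k,
      ∀ F, EdgeSet I F → extend x F = diff k (slots I) (blocks I) y F := by
    intro I
    obtain ⟨L, hLI, hL, hLcrit⟩ := exists_essential_iff I
    refine exists_eq_diff L hLI hL _ (fun F hF => ?_) fun F hF hFL => ?_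
    · by_cases hc : F.card = n + 1
      · have h := vertexAppend_apply_extend x
          ⟨ofAdmissible hF, by rw [edges_ofAdmissible, hc]⟩
        simp only [hdx, nonTips_ofAdmissible, edges_ofAdmissible] at h
        exact h.symm
      · rw [diff_apply]
        refine Finset.sum_eq_zero fun e he => ?_
        have heF := (Finset.mem_filter.1 he).1
        rw [extend_of_card_ne, mul_zero]
        have := Finset.card_erase_add_one heF
        omega
    · by_cases hc : F.card = n
      · have h := extend_edges x ⟨ofAdmissible hF, by rw [edges_ofAdmissible, hc]⟩
        simp only [edges_ofAdmissible] at h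
        rw [h]
        refine hx _ ((hLcrit _ (nonTips_ofAdmissible hF)).1 ?_)
        rwa [edges_ofAdmissible]
      · exact extend_of_card_ne x hc
  choose y hy using key
  exact ⟨y, fun T => by rw [← hy _ _ T.1.edges_admissible, extend_edges]⟩

/-- The values of a cocycle at the critical bonsais can be prescribed. -/
theorem exists_cocycle_eq {n : ℕ} (w : {T : Bonsai m // T.edges.card = n} → k) :
    ∃ z : Cochain k m n, vertexAppend k m n z = 0 ∧
      ∀ T : {T : Bonsai m // T.edges.card = n}, T.1.IsCritical → z T = w T := by
  classical
  set x : Cochain k m n := Finsupp.equivFunOnFinite.symm w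
  have key : ∀ I : Finset (List (Fin m)), ∃ z : Finset (List (Fin m)) → k,
      (∀ F, EdgeSet I F → diff k (slots I) (blocks I) z F = 0) ∧
      ∀ T : Bonsai m, T.nonTips = I → T.IsCritical → z T.edges = extend x T.edges := by
    intro I
    obtain ⟨L, hLI, hL, hLcrit⟩ := exists_essential_iff I
    obtain ⟨z, hz, hzx⟩ := exists_cocycle (k := k) L hLI hL (extend x) (fun F hF hFL => by
      have hcrit := (hLcrit _ (nonTips_ofAdmissible hF)).1 (by rwa [edges_ofAdmissible])
      rw [diff_apply, Finset.filter_false_of_mem, Finset.sum_empty]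
      intro e he
      have h := hcrit.not_edgeSet_erase (e := e) (by rwa [edges_ofAdmissible])
      rwa [nonTips_ofAdmissible, edges_ofAdmissible] at h)
    refine ⟨z, hz, ?_⟩
    rintro T rfl hT
    exact hzx _ T.edges_admissible ((hLcrit T rfl).2 hT)
  choose z hz hzx using key
  refine ⟨glue z n, ?_, fun T hT => ?_⟩
  · ext T
    rw [vertexAppend_glue, hz _ _ T.1.edges_admissible, Finsupp.zero_apply]
  · simp only [glue, Finsupp.equivFunOnFinite_symm_apply_apply]
    rw [hzx _ T.1 rfl hT, extend_edges]
    rfl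

end Cohomology

/-- The homology of a short complex of vector spaces, computed by a linear map that kills the
boundaries, restricts to a surjection on the cycles and is injective modulo boundaries. -/
theorem nonempty_homology_equiv {k : Type u} [Field k] (S : ShortComplex (ModuleCat.{u} k))
    {W : Type*} [AddCommGroup W] [Module k W] (ρ : S.X₂ →ₗ[k] W)
    (h1 : ∀ y : S.X₁, ρ (S.f.hom y) = 0)
    (h2 : ∀ x : S.X₂, S.g.hom x = 0 → ρ x = 0 → ∃ y, S.f.hom y = x)
    (h3 : ∀ w : W, ∃ x, S.g.hom x = 0 ∧ ρ x = w) : Nonempty (S.homology ≃ₗ[k] W) := by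
  have hker : LinearMap.range S.moduleCatToCycles =
      LinearMap.ker (ρ ∘ₗ (LinearMap.ker S.g.hom).subtype) := by
    ext ⟨x, hx⟩
    rw [LinearMap.mem_ker, LinearMap.mem_range]
    constructor
    · rintro ⟨y, hy⟩
      rw [← hy]
      exact h1 y
    · intro h
      obtain ⟨y, hy⟩ := h2 x hx h
      exact ⟨y, Subtype.ext hy⟩
  have hsurj : Function.Surjective (ρ ∘ₗ (LinearMap.ker S.g.hom).subtype) := by
    intro w
    obtain ⟨x, hx, hw⟩ := h3 w
    exact ⟨⟨x, hx⟩, hw⟩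
  exact ⟨S.moduleCatHomologyIso.toLinearEquiv ≪≫ₗ
    Submodule.quotEquivOfEq _ _ hker ≪≫ₗ LinearMap.quotKerEquivOfSurjective _ hsurj⟩

theorem complex_d (k : Type u) [Field k] (m n : ℕ) :
    (complex k m).d n (n + 1) = ModuleCat.ofHom (vertexAppend k m n) :=
  CochainComplex.of_d (fun n => ModuleCat.of k (Cochain k m n))
    (fun n => ModuleCat.ofHom (vertexAppend k m n)) n

/-- The cohomology in degree `i` has a basis indexed by the critical bonsais with `i` edges. -/
theorem nonempty_homology_equiv_critical (k : Type u) [Field k] [NeZero m] (i : ℕ) :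
    Nonempty ((complex k m).homology i ≃ₗ[k]
      ({T : {T : Bonsai m // T.edges.card = i} // T.1.IsCritical} → k)) := by
  classical
  obtain ⟨j, hj⟩ : ∃ j, (ComplexShape.up ℕ).prev i = j := ⟨_, rfl⟩
  let e := (complex k m).homologyIsoSc' j i (i + 1) hj (CochainComplex.next ℕ i)
  let ρ : Cochain k m i →ₗ[k] ({T : {T : Bonsai m // T.edges.card = i} // T.1.IsCritical} → k) :=
    LinearMap.pi fun T => Finsupp.lapply T.1
  have hg : ∀ x : Cochain k m i, ((complex k m).d i (i + 1)).hom x = vertexAppend k m i x := by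
    intro x
    rw [complex_d]
    rfl
  have h1 : ∀ y : (complex k m).X j, ρ (((complex k m).d j i).hom y) = 0 := by
    intro y
    cases i with
    | zero =>
      rw [(complex k m).shape j 0 (by simp)]
      exact map_zero ρ
    | succ n =>
      obtain rfl : n = j := by rw [← hj, CochainComplex.prev_nat_succ]
      rw [complex_d]
      ext T
      exact vertexAppend_apply_of_isCritical (k := k) (n := n) y T.1 T.2
  have h2 : ∀ x : Cochain k m i, ((complex k m).d i (i + 1)).hom x = 0 → ρ x = 0 →
      ∃ y, ((complex k m).d j i).hom y = x := by
    intro x hx hρ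
    obtain ⟨y, hy⟩ := exists_primitive x ((hg x).symm.trans hx)
      fun T hT => congrFun hρ ⟨T, hT⟩
    cases i with
    | zero =>
      refine ⟨0, ?_⟩
      rw [map_zero]
      symm
      refine Finsupp.ext fun T => ?_
      rw [hy T, Finset.card_eq_zero.1 T.2]
      simp only [diff_apply, Finset.filter_empty, Finset.sum_empty]
      rfl
    | succ n =>
      obtain rfl : n = j := by rw [← hj, CochainComplex.prev_nat_succ]
      refine ⟨glue y n, ?_⟩
      rw [complex_d]
      refine Finsupp.ext fun T => ?_
      rw [hy T]
      exact vertexAppend_glue y n T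
  have h3 : ∀ w, ∃ x : Cochain k m i, ((complex k m).d i (i + 1)).hom x = 0 ∧ ρ x = w := by
    intro w
    obtain ⟨z, hz, hzw⟩ := exists_cocycle_eq (k := k)
      fun T => if h : T.1.IsCritical then w ⟨T, h⟩ else 0
    refine ⟨z, (hg z).trans hz, ?_⟩
    ext T
    exact (hzw T.1 T.2).trans (dif_pos T.2)
  obtain ⟨e'⟩ := nonempty_homology_equiv ((complex k m).sc' j i (i + 1)) ρ h1 h2 h3
  exact ⟨e.toLinearEquiv ≪≫ₗ e'⟩

end Bonsai

/-! ### Full `m`-ary trees and the numbers of forests -/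

/-- Full `m`-ary trees: each node is a leaf or has exactly `m` ordered children. -/
inductive FullTree (m : ℕ) : Type
  | leaf : FullTree m
  | node (f : Fin m → FullTree m) : FullTree m

namespace FullTree

variable {m : ℕ}

/-- The number of nodes that are not leaves. -/
def numNodes : FullTree m → ℕ
  | leaf => 0
  | node f => (∑ a, (f a).numNodes) + 1

variable (m) in
/-- The ordered forests of `r` full `m`-ary trees with `n` non-leaf nodes in total. -/
abbrev Forest (r n : ℕ) : Type :=
  {f : Fin r → FullTree m // ∑ i, (f i).numNodes = n}

/-- A nonempty forest arises from a smaller one by putting a leaf in front, or by joining the first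
`m` trees under a new root. -/
noncomputable def forestSuccEquiv (r n : ℕ) :
    Forest m r n ⊕ {h : Fin (m + r) → FullTree m // (∑ i, (h i).numNodes) + 1 = n} ≃
      Forest m (r + 1) n :=
  Equiv.ofBijective
    (Sum.elim
      (fun g => ⟨Fin.cons leaf g.1, by simp [Fin.sum_univ_succ, numNodes, g.2]⟩)
      (fun h => ⟨Fin.cons (node fun i => h.1 (Fin.castAdd r i)) fun j => h.1 (Fin.natAdd m j), by
        have := h.2
        rw [Fin.sum_univ_add] at this
        simp only [Fin.sum_univ_succ, Fin.cons_zero, Fin.cons_succ, numNodes]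
        omega⟩)) (by
    constructor
    · rintro (⟨g, hg⟩ | ⟨h, hh⟩) (⟨g', hg'⟩ | ⟨h', hh'⟩) heq <;>
        simp only [Sum.elim_inl, Sum.elim_inr, Subtype.mk.injEq, Fin.cons_inj, reduceCtorEq,
          false_and, true_and, node.injEq] at heq
      · simp [heq]
      · congr 2
        ext i
        refine Fin.addCases (fun i => ?_) (fun j => ?_) i
        · exact congrFun heq.1 i
        · exact congrFun heq.2 j
    · rintro ⟨f, hf⟩
      rw [Fin.sum_univ_succ] at hf
      cases h0 : f 0 with
      | leaf =>
        refine ⟨Sum.inl ⟨Fin.tail f, ?_⟩, Subtype.ext ?_⟩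
        · rw [h0] at hf
          simpa [numNodes, Fin.tail] using hf
        · simp only [Sum.elim_inl]
          rw [← h0, Fin.cons_self_tail]
      | node t =>
        refine ⟨Sum.inr ⟨Fin.append t (Fin.tail f), ?_⟩, Subtype.ext ?_⟩
        · rw [h0] at hf
          simp only [numNodes] at hf
          simp only [Fin.sum_univ_add, Fin.append_left, Fin.append_right, Fin.tail]
          omega
        · simp only [Sum.elim_inr, Fin.append_left, Fin.append_right]
          rw [← h0]
          exact Fin.cons_self_tail f)

/-- The part of `forestSuccEquiv` for forests without non-leaf nodes. -/
noncomputable def forestSuccZeroEquiv (r : ℕ) : Forest m r 0 ≃ Forest m (r + 1) 0 :=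
  have : IsEmpty {h : Fin (m + r) → FullTree m // (∑ i, (h i).numNodes) + 1 = 0} :=
    ⟨fun h => Nat.succ_ne_zero _ h.2⟩
  (Equiv.sumEmpty _ _).symm.trans (forestSuccEquiv r 0)

/-- The part of `forestSuccEquiv` for forests with a non-leaf node. -/
noncomputable def forestSuccSuccEquiv (r n : ℕ) :
    Forest m r (n + 1) ⊕ Forest m (m + r) n ≃ Forest m (r + 1) (n + 1) :=
  (Equiv.sumCongr (Equiv.refl _) (Equiv.subtypeEquivRight fun h => by simp)).trans
    (forestSuccEquiv r (n + 1))

instance (n : ℕ) : IsEmpty (Forest m 0 (n + 1)) := ⟨fun f => by simpa using f.2⟩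

instance : Unique (Forest m 0 0) where
  default := ⟨Fin.elim0, by simp⟩
  uniq f := Subtype.ext (Subsingleton.elim _ _)

instance finite_forest (r n : ℕ) : Finite (Forest m r n) := by
  induction n generalizing r with
  | zero =>
    induction r with
    | zero => infer_instance
    | succ r ih => exact Finite.of_equiv _ (forestSuccZeroEquiv r)
  | succ n ihn =>
    induction r with
    | zero => infer_instance
    | succ r ih => exact Finite.of_equiv _ (forestSuccSuccEquiv r n)

theorem card_forest_zero (r : ℕ) : Nat.card (Forest m r 0) = 1 := by
  induction r with
  | zero => exact Nat.card_unique
  | succ r ih => rw [← Nat.card_congr (forestSuccZeroEquiv r), ih]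

theorem card_forest_succ_succ (r n : ℕ) : Nat.card (Forest m (r + 1) (n + 1)) =
    Nat.card (Forest m r (n + 1)) + Nat.card (Forest m (m + r) n) := by
  rw [← Nat.card_congr (forestSuccSuccEquiv r n), Nat.card_sum]

/-- The number of forests of `r ≥ 1` trees with `n` non-leaf nodes is the Raney number
`r / (m * n + r) * (m * n + r).choose n`, which satisfies the recursion `card_forest_succ_succ`. -/
theorem card_forest (M r n : ℕ) : Nat.card (Forest (M + 1) (r + 1) n) *
    ((M * n + r + 1)! * n !) = (r + 1) * ((M + 1) * n + r)! := by
  induction n generalizing r with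
  | zero => simp [card_forest_zero, Nat.factorial_succ]
  | succ n ihn =>
    induction r with
    | zero =>
      have h := ihn M
      rw [card_forest_succ_succ, Nat.card_of_isEmpty, zero_add, add_zero]
      have e1 : M * (n + 1) + 0 + 1 = M * n + M + 1 := by ring
      have e2 : (M + 1) * (n + 1) + 0 = ((M + 1) * n + M) + 1 := by ring
      rw [e1, e2, Nat.factorial_succ n, Nat.factorial_succ ((M + 1) * n + M)]
      linear_combination (n + 1) * h
    | succ r ihr =>
      have h := ihn (M + 1 + r)
      rw [card_forest_succ_succ]
      have e0 : M + 1 + (r + 1) = M + 1 + r + 1 := by ring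
      have e1 : M * (n + 1) + (r + 1) + 1 = (M * (n + 1) + r + 1) + 1 := by ring
      have e2 : (M + 1) * (n + 1) + (r + 1) = ((M + 1) * (n + 1) + r) + 1 := by ring
      have e3 : M * n + (M + 1 + r) + 1 = (M * (n + 1) + r + 1) + 1 := by ring
      have e4 : (M + 1) * n + (M + 1 + r) = (M + 1) * (n + 1) + r := by ring
      rw [e3, e4] at h
      rw [e0, e1, e2, Nat.factorial_succ ((M + 1) * (n + 1) + r)]
      rw [Nat.factorial_succ (M * (n + 1) + r + 1)] at h ⊢
      rw [Nat.factorial_succ n] at ihr ⊢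
      linear_combination (M * (n + 1) + r + 1 + 1) * ihr + (n + 1) * h

/-- Full `m`-ary trees with `n` non-leaf nodes are counted by the `m`-Catalan numbers. -/
theorem card_numNodes_eq (m n : ℕ) (hm : 1 ≤ m) :
    Nat.card {t : FullTree m // t.numNodes = n} * (((m - 1) * n + 1)! * n !) = (m * n)! := by
  obtain ⟨M, rfl⟩ := Nat.exists_eq_add_of_le' hm
  have h := card_forest M 0 n
  have e : Forest (M + 1) 1 n ≃ {t : FullTree (M + 1) // t.numNodes = n} :=
    Equiv.subtypeEquiv (Equiv.funUnique (Fin 1) _) fun f => by simp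
  rw [zero_add, Nat.card_congr e] at h
  simpa using h

/-! ### Full trees as critical bonsais -/

variable [NeZero m]

/-- The vertices of the critical bonsai attached to a full tree: the nodes of the tree and, below
each leaf, one more vertex with label `0`. -/
def verts : FullTree m → Finset (List (Fin m))
  | leaf => {[], [0]}
  | node f => insert [] (Finset.univ.biUnion fun a => (f a).verts.image (List.cons a))

theorem nil_mem_verts (t : FullTree m) : [] ∈ t.verts := by
  cases t <;> simp [verts]

theorem cons_mem_verts_node {f : Fin m → FullTree m} {a : Fin m} {w : List (Fin m)} :
    a :: w ∈ (node f).verts ↔ w ∈ (f a).verts := by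
  simp only [verts, Finset.mem_insert, reduceCtorEq, Finset.mem_biUnion, Finset.mem_univ,
    Finset.mem_image, List.cons.injEq, true_and, false_or]
  constructor
  · rintro ⟨b, w', h, rfl, rfl⟩
    exact h
  · intro h
    exact ⟨a, w, h, rfl, rfl⟩

theorem mem_verts_of_append_mem (t : FullTree m) (v : List (Fin m)) (a : Fin m)
    (h : v ++ [a] ∈ t.verts) : v ∈ t.verts := by
  induction t generalizing v with
  | leaf =>
    cases v with
    | nil => exact nil_mem_verts _
    | cons b v => simp [verts] at h
  | node f ih =>
    cases v with
    | nil => exact nil_mem_verts _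
    | cons b v =>
      rw [List.cons_append, cons_mem_verts_node] at h
      exact cons_mem_verts_node.2 (ih b v h)

theorem exists_singleton_mem_verts (t : FullTree m) : ∃ a, [a] ∈ t.verts := by
  cases t with
  | leaf => exact ⟨0, by simp [verts]⟩
  | node f => exact ⟨0, cons_mem_verts_node.2 (nil_mem_verts _)⟩

theorem verts_leaf_ne_verts_node (f : Fin m → FullTree m) : (leaf : FullTree m).verts ≠
    (node f).verts := by
  intro h
  obtain ⟨b, hb⟩ := exists_singleton_mem_verts (f 0)
  have h2 : [0, b] ∈ (leaf : FullTree m).verts := h ▸ cons_mem_verts_node.2 hb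
  simp [verts] at h2

theorem verts_injective : Function.Injective (verts : FullTree m → Finset (List (Fin m))) := by
  intro t
  induction t with
  | leaf =>
    intro t' h
    cases t' with
    | leaf => rfl
    | node f => exact absurd h (verts_leaf_ne_verts_node f)
  | node f ih =>
    intro t' h
    cases t' with
    | leaf => exact absurd h.symm (verts_leaf_ne_verts_node f)
    | node g =>
      congr 1
      ext1 a
      refine ih a (Finset.ext fun w => ?_)
      rw [← cons_mem_verts_node, ← cons_mem_verts_node, h]

theorem card_verts (t : FullTree m) : t.verts.card = (2 * m - 1) * t.numNodes + 2 := by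
  have hm := NeZero.pos m
  induction t with
  | leaf => simp [verts, numNodes]
  | node f ih =>
    rw [verts, Finset.card_insert_of_notMem (by simp), Finset.card_biUnion]
    · have h : ∀ a, ((f a).verts.image (List.cons a)).card = (2 * m - 1) * (f a).numNodes + 2 := by
        intro a
        rw [Finset.card_image_of_injective _ List.cons_injective, ih]
      simp only [h, numNodes, Finset.sum_add_distrib, ← Finset.mul_sum, Finset.sum_const,
        Finset.card_univ, Fintype.card_fin, smul_eq_mul, mul_add]
      omega
    · intro a _ b _ hab
      rw [Function.onFun, Finset.disjoint_left]
      intro w hw hw'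
      obtain ⟨u, -, rfl⟩ := Finset.mem_image.1 hw
      obtain ⟨u', -, h⟩ := Finset.mem_image.1 hw'
      exact hab (List.cons.inj h).1.symm

/-- The critical bonsai attached to a full tree. -/
def toBonsai (t : FullTree m) : Bonsai m where
  verts := t.verts
  root_mem := t.nil_mem_verts
  parent_mem := t.mem_verts_of_append_mem

theorem card_edges_toBonsai (t : FullTree m) :
    t.toBonsai.edges.card = (2 * m - 1) * t.numNodes + 1 := by
  rw [Bonsai.edges, Finset.card_erase_of_mem t.toBonsai.root_mem]
  exact congrArg (· - 1) t.card_verts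

theorem isCritical_toBonsai (t : FullTree m) : t.toBonsai.IsCritical := by
  intro v hv
  simp only [Bonsai.mem_nonTips, toBonsai] at hv ⊢
  induction t generalizing v with
  | leaf =>
    right
    intro a ha
    simp only [verts, Finset.mem_insert, Finset.mem_singleton] at ha ⊢
    cases v with
    | nil => simpa using ha
    | cons b v => simp at ha
  | node f ih =>
    cases v with
    | nil =>
      left
      intro a
      obtain ⟨b, hb⟩ := exists_singleton_mem_verts (f a)
      exact ⟨b, cons_mem_verts_node.2 hb⟩
    | cons c v =>
      simp only [List.cons_append, cons_mem_verts_node] at hv ⊢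
      exact ih c v hv

end FullTree

namespace Bonsai

variable {m : ℕ} [NeZero m]

omit [NeZero m] in
/-- The part of a bonsai below the vertex at the lower end of the edge `a` at the root. -/
noncomputable def branch (T : Bonsai m) (a : Fin m) (ha : [a] ∈ T.verts) : Bonsai m where
  verts := T.verts.preimage (List.cons a) List.cons_injective.injOn
  root_mem := by simpa using ha
  parent_mem v b h := by
    simp only [Finset.mem_preimage] at h ⊢
    exact T.parent_mem (a :: v) b h

omit [NeZero m] in
theorem mem_verts_branch {T : Bonsai m} {a : Fin m} {ha : [a] ∈ T.verts} {w : List (Fin m)} :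
    w ∈ (T.branch a ha).verts ↔ a :: w ∈ T.verts := by
  simp [branch]

omit [NeZero m] in
theorem mem_nonTips_branch {T : Bonsai m} {a : Fin m} {ha : [a] ∈ T.verts} {w : List (Fin m)} :
    w ∈ (T.branch a ha).nonTips ↔ a :: w ∈ T.nonTips := by
  simp [mem_nonTips, mem_verts_branch]

omit [NeZero m] in
theorem card_verts_branch_lt (T : Bonsai m) (a : Fin m) (ha : [a] ∈ T.verts) :
    (T.branch a ha).verts.card < T.verts.card := by
  rw [← Finset.card_image_of_injective _ (List.cons_injective (a := a))]
  refine Finset.card_lt_card (Finset.ssubset_iff_of_subset ?_ |>.2 ⟨[], T.root_mem, by simp⟩)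
  intro w hw
  obtain ⟨u, hu, rfl⟩ := Finset.mem_image.1 hw
  exact mem_verts_branch.1 hu

/-- A critical bonsai with at least one edge comes from a full tree. -/
theorem IsCritical.exists_toBonsai_eq {T : Bonsai m} (hT : T.IsCritical)
    (hroot : [] ∈ T.nonTips) : ∃ t : FullTree m, t.toBonsai = T := by
  induction hn : T.verts.card using Nat.strong_induction_on generalizing T with
  | _ n ih =>
  subst hn
  rcases hT [] hroot with hall | hone
  · have hv : ∀ a, [a] ∈ T.verts := fun a => mem_verts_of_mem_nonTips (hall a)
    have hex : ∀ a, ∃ t : FullTree m, t.toBonsai = T.branch a (hv a) := by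
      intro a
      refine ih _ (T.card_verts_branch_lt a (hv a)) (T := T.branch a (hv a)) ?_
        (mem_nonTips_branch.2 (hall a)) rfl
      intro v hvn
      simp only [mem_nonTips_branch, mem_verts_branch] at hvn ⊢
      exact hT (a :: v) hvn
    choose f hf using hex
    refine ⟨FullTree.node f, Bonsai.ext (Finset.ext fun w => ?_)⟩
    cases w with
    | nil => exact iff_of_true (FullTree.nil_mem_verts _) T.root_mem
    | cons a w =>
      refine FullTree.cons_mem_verts_node.trans ?_
      rw [← mem_verts_branch (ha := hv a), ← hf]
      rfl
  · obtain ⟨c, hc⟩ := mem_nonTips.1 hroot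
    obtain rfl := (hone c hc).1
    refine ⟨FullTree.leaf, Bonsai.ext (Finset.ext fun w => ?_)⟩
    simp only [FullTree.toBonsai, FullTree.verts, Finset.mem_insert, Finset.mem_singleton]
    constructor
    · rintro (rfl | rfl)
      · exact T.root_mem
      · exact hc
    · intro hw
      match w, hw with
      | [], _ => exact Or.inl rfl
      | [a], hw => exact Or.inr (by rw [(hone a hw).1])
      | a :: b :: w, hw =>
        have hab : [a] ++ [b] ∈ T.verts := mem_verts_of_append_mem (v := w) hw
        exact absurd (mem_nonTips.2 ⟨b, hab⟩) (hone a (T.parent_mem _ _ hab)).2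

omit [NeZero m] in
theorem nil_mem_nonTips {T : Bonsai m} (hT : 1 ≤ T.edges.card) : [] ∈ T.nonTips := by
  obtain ⟨w, hw⟩ := Finset.card_pos.1 hT
  cases w with
  | nil => simp [edges] at hw
  | cons a w =>
    exact mem_nonTips.2 ⟨a, mem_verts_of_append_mem (v := w) (Finset.mem_of_mem_erase hw)⟩

theorem IsCritical.exists_card_edges_eq {T : Bonsai m} (hT : T.IsCritical)
    (h1 : 1 ≤ T.edges.card) : ∃ n, T.edges.card = (2 * m - 1) * n + 1 := by
  obtain ⟨t, rfl⟩ := hT.exists_toBonsai_eq (nil_mem_nonTips h1)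
  exact ⟨_, t.card_edges_toBonsai⟩

theorem card_isCritical (n : ℕ) :
    Nat.card {T : {T : Bonsai m // T.edges.card = (2 * m - 1) * n + 1} // T.1.IsCritical} =
      Nat.card {t : FullTree m // t.numNodes = n} := by
  have hm := NeZero.pos m
  symm
  refine Nat.card_congr (Equiv.ofBijective
    (fun t => ⟨⟨t.1.toBonsai, by rw [t.1.card_edges_toBonsai, t.2]⟩, t.1.isCritical_toBonsai⟩)
    ⟨fun t t' h => ?_, ?_⟩)
  · simp only [Subtype.mk.injEq] at h
    exact Subtype.ext (FullTree.verts_injective (congrArg Bonsai.verts h))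
  · rintro ⟨⟨T, hTn⟩, hT⟩
    obtain ⟨t, rfl⟩ := hT.exists_toBonsai_eq (nil_mem_nonTips (by rw [hTn]; omega))
    refine ⟨⟨t, ?_⟩, rfl⟩
    rw [t.card_edges_toBonsai] at hTn
    exact Nat.eq_of_mul_eq_mul_left (by omega : 0 < 2 * m - 1) (by omega)

theorem card_isCritical_zero :
    Nat.card {T : {T : Bonsai m // T.edges.card = 0} // T.1.IsCritical} = 1 := by
  rw [Nat.card_eq_one_iff_unique]
  refine ⟨⟨fun T T' => ?_⟩, ⟨⟨⟨⟨{[]}, by simp, by simp⟩, by simp [edges]⟩, ?_⟩⟩⟩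
  · refine Subtype.ext (edges_val_injective ?_)
    simp only [Finset.card_eq_zero.1 T.1.2, Finset.card_eq_zero.1 T'.1.2]
  · intro v hv
    simp [mem_nonTips] at hv

end Bonsai

theorem mainTheorem1 (k : Type u) [Field k] (m : ℕ) (hm : 1 ≤ m) :
    (∀ n : ℕ,
      ((m - 1) * n + 1)! * n ! ∣ (m * n)! ∧
      Nonempty ((Bonsai.complex k m).homology ((2 * m - 1) * n + 1) ≃ₗ[k]
        (Fin ((m * n)! / (((m - 1) * n + 1)! * n !)) → k))) ∧
    (∀ i : ℕ, 1 ≤ i → (∀ n : ℕ, i ≠ (2 * m - 1) * n + 1) →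
      Subsingleton ((Bonsai.complex k m).homology i)) ∧
    Nonempty ((Bonsai.complex k m).homology 0 ≃ₗ[k] k) := by
  have : NeZero m := ⟨by omega⟩
  refine ⟨fun n => ?_, fun i hi hin => ?_, ?_⟩
  · have hcard := FullTree.card_numNodes_eq m n hm
    refine ⟨Dvd.intro_left _ hcard, ?_⟩
    obtain ⟨e⟩ := Bonsai.nonempty_homology_equiv_critical (m := m) k ((2 * m - 1) * n + 1)
    have hdiv : Nat.card {T : {T : Bonsai m // T.edges.card = (2 * m - 1) * n + 1} //
        T.1.IsCritical} = (m * n)! / (((m - 1) * n + 1)! * n !) := by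
      rw [Bonsai.card_isCritical, ← hcard, Nat.mul_div_cancel _ (by positivity)]
    exact ⟨e ≪≫ₗ LinearEquiv.funCongrLeft k k (Finite.equivFinOfCardEq hdiv).symm⟩
  · obtain ⟨e⟩ := Bonsai.nonempty_homology_equiv_critical (m := m) k i
    have : IsEmpty {T : {T : Bonsai m // T.edges.card = i} // T.1.IsCritical} := by
      refine ⟨fun T => ?_⟩
      obtain ⟨n, hn⟩ := T.2.exists_card_edges_eq (by rw [T.1.2]; exact hi)
      exact hin n (T.1.2.symm.trans hn)
    exact e.injective.subsingleton
  · obtain ⟨e⟩ := Bonsai.nonempty_homology_equiv_critical (m := m) k 0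
    have e1 := Finite.equivFinOfCardEq (Bonsai.card_isCritical_zero (m := m))
    exact ⟨e ≪≫ₗ LinearEquiv.funCongrLeft k k e1.symm ≪≫ₗ LinearEquiv.funUnique (Fin 1) k k⟩
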